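/- Let $\mathbb D=\{a+b\epsilon: a,b\in\mathbb R\}$ and $\mathbb{DC}=\{a+b\epsilon : a,b\in\mathbb C\}$ with $\epsilon\neq 0$, $\epsilon^2=0$ be the dual numbers and the dual complex numbers; $a$ is the standard part and $b$ the infinitesimal part of $a+b\epsilon$. Order $\mathbb D$ totally by $a+b\epsilon\le c+d\epsilon$ iff $a<c$, or $a=c$ and $b\le d$. Put $\sqrt{a+b\epsilon}=\sqrt a+\frac{b}{2\sqrt a}\epsilon$ for $a>0$ and $\sqrt 0=0$. Put $\overline{a+b\epsilon}=\bar a+\bar b\epsilon$, and let $M^*$ be the conjugate transpose; a square matrix $U$ over $\mathbb{DC}$ is unitary if $U^*U=I$. The magnitude of $q=a+b\epsilon\in\mathbb{DC}$ is $|q|=|a|+\frac{\operatorname{Re}(\bar a b)}{|a|}\epsilon$ if $a\ne0$, and $|q|=|b|\epsilon$ if $a=0$. The Frobenius norm of $M=M_{st}+M_{\mathcal I}\epsilon\in\mathbb{DC}^{m\times n}$ is the dual number $\|M\|_F=\sqrt{\sum_{i,j}|m_{ij}|^2}$ if $M_{st}\neq O$, and $\|M\|_F=\|M_{\mathcal I}\|_F\,\epsilon$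 if $M_{st}=O$. Every $M\in\mathbb{DC}^{m\times n}$ has a singular value decomposition $U^*MV=\begin{bmatrix}\Sigma&O\\O&O\end{bmatrix}$ with $U\in\mathbb{DC}^{m\times m}$, $V\in\mathbb{DC}^{n\times n}$ unitary, $\Sigma=\operatorname{diag}(\sigma_1,\dots,\sigma_t)$, and dual numbers $\sigma_1\ge\dots\ge\sigma_t>0$ (appreciable, i.e. with nonzero standard part, or infinitesimal), $t\le\min\{m,n\}$; the matrix $\Sigma$ is uniquely determined by $M$, and $t$ is called the rank of $M$. **Theorem 7.1.** Let $A\in\mathbb{DC}^{m\times n}$ have the singular value decomposition $A=\sum_{j=1}^r\mu_j\mathbf u_j\mathbf v_j^*$, where $\mu_1\ge\dots\ge\mu_r>0$ are dual numbers (appreciable or infinitesimal), and $\mathbf u_1,\dots,\mathbf u_r\in\mathbb{DC}^m$ and $\mathbf v_1,\dots,\mathbf v_r\in\mathbb{DC}^n$ are orthonormal, that is, $\mathbf u_i^*\mathbf u_j=\mathbf v_i^*\mathbf v_j=\delta_{ij}$. Let $0\le k\le r$ and $A_k=\sum_{j=1}^k\mu_j\mathbf u_j\mathbf v_j^*$.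 Then $$\|A-A_k\|_F\le\|A-B\|_F$$ in the total order of $\mathbb D$, for every $B\in\mathbb{DC}^{m\times n}$ of rank at most $k$. -/

import Mathlib

open scoped DualNumber Matrix

/-! ### Dual numbers `ℝ[ε]`: total order and square root -/

/-- The total (lexicographic) order on dual numbers: `p ≤ q` iff the standard part of `p` is
smaller, or the standard parts agree and the infinitesimal part of `p` is at most that of `q`. -/
noncomputable instance DualNumber.instLinearOrderReal : LinearOrder ℝ[ε] where
  le p q := p.fst < q.fst ∨ (p.fst = q.fst ∧ p.snd ≤ q.snd)
  le_refl p := Or.inr ⟨rfl, le_rfl⟩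
  le_trans p q r := by
    rintro (h | ⟨h, h'⟩) (g | ⟨g, g'⟩)
    · exact Or.inl (h.trans g)
    · exact Or.inl (g ▸ h)
    · exact Or.inl (h ▸ g)
    · exact Or.inr ⟨h.trans g, h'.trans g'⟩
  le_antisymm p q := by
    rintro (h | ⟨h, h'⟩) (g | ⟨g, g'⟩)
    · exact absurd h g.asymm
    · exact absurd g h.ne'
    · exact absurd h g.ne'
    · exact TrivSqZeroExt.ext h (le_antisymm h' g')
  le_total p q := by
    rcases lt_trichotomy p.fst q.fst with h | h | h
    · exact Or.inl (Or.inl h)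
    · rcases le_total p.snd q.snd with h' | h'
      · exact Or.inl (Or.inr ⟨h, h'⟩)
      · exact Or.inr (Or.inr ⟨h.symm, h'⟩)
    · exact Or.inr (Or.inl h)
  toDecidableLE := Classical.decRel _

theorem DualNumber.le_iff_real (p q : ℝ[ε]) :
    p ≤ q ↔ p.fst < q.fst ∨ (p.fst = q.fst ∧ p.snd ≤ q.snd) := Iff.rfl

/-! ### Dual complex numbers `ℂ[ε]`: conjugation -/

/-- Conjugation of dual complex numbers, `star (a + b ε) = conj a + conj b ε`. With this
instance `Aᴴ` is the conjugate transpose of a dual complex matrix, and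
`Matrix.unitaryGroup (Fin n) ℂ[ε]` consists of the unitary dual complex matrices. -/
instance DualNumber.instStarRingComplex : StarRing ℂ[ε] where
  star q := TrivSqZeroExt.inl (star q.fst) + TrivSqZeroExt.inr (star q.snd)
  star_involutive q := by ext <;> simp
  star_mul p q := by ext <;> simp [mul_comm, add_comm]
  star_add p q := by ext <;> simp

namespace DualComplex

/-- The square root of a dual number: `√(a + b ε) = √a + b / (2 √a) ε` for `a > 0`, and `√0 = 0`
(it is only used for nonnegative dual numbers of one of these two kinds). -/
noncomputable def dualSqrt (q : ℝ[ε]) : ℝ[ε] :=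
  if 0 < q.fst then
    TrivSqZeroExt.inl (Real.sqrt q.fst) + TrivSqZeroExt.inr (q.snd / (2 * Real.sqrt q.fst))
  else 0

/-- The inclusion of the dual numbers into the dual complex numbers. -/
noncomputable def ofDual (q : ℝ[ε]) : ℂ[ε] :=
  TrivSqZeroExt.inl (q.fst : ℂ) + TrivSqZeroExt.inr (q.snd : ℂ)

open Classical in
/-- The magnitude of a dual complex number `(q₁ + q₂ i) + (q₃ + q₄ i) ε`, a dual number. -/
noncomputable def magnitude (q : ℂ[ε]) : ℝ[ε] :=
  if q.fst ≠ 0 then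
    TrivSqZeroExt.inl ‖q.fst‖ +
      TrivSqZeroExt.inr ((q.fst.re * q.snd.re + q.fst.im * q.snd.im) / ‖q.fst‖)
  else TrivSqZeroExt.inr ‖q.snd‖

variable {m n : ℕ}

open Classical in
/-- The Frobenius norm of a dual complex matrix, a dual number: `√(∑ |aᵢⱼ|²)` if the standard part
of the matrix is nonzero, and otherwise `ε` times the Frobenius norm of the infinitesimal part. -/
noncomputable def frobeniusNorm (A : Matrix (Fin m) (Fin n) ℂ[ε]) : ℝ[ε] :=
  if A.map TrivSqZeroExt.fst ≠ 0 then dualSqrt (∑ i, ∑ j, magnitude (A i j) ^ 2)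
  else TrivSqZeroExt.inr (Real.sqrt (∑ i, ∑ j, ‖(A i j).snd‖ ^ 2))

/-- The `m × n` matrix `[Σ 0; 0 0]` with `Σ = diag(μ₁, …, μₜ)`. -/
noncomputable def rectDiagonal {t : ℕ} (μ : Fin t → ℝ[ε]) : Matrix (Fin m) (Fin n) ℂ[ε] :=
  Matrix.of fun i j =>
    if h : (i : ℕ) < t then (if (i : ℕ) = j then ofDual (μ ⟨i, h⟩) else 0) else 0

/-- `Uᴴ A V = [Σ 0; 0 0]` is a singular value decomposition of `A`: `U` and `V` are unitary, and
`Σ = diag(μ₁, …, μₜ)` with dual numbers `μ₁ ≥ ⋯ ≥ μₜ > 0`, `t ≤ min(m, n)`. In the total order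
appreciable positive dual numbers exceed the infinitesimal ones, so the appreciable
`μⱼ` come first. -/
structure IsSVD (A : Matrix (Fin m) (Fin n) ℂ[ε]) (t : ℕ)
    (U : Matrix (Fin m) (Fin m) ℂ[ε]) (V : Matrix (Fin n) (Fin n) ℂ[ε])
    (μ : Fin t → ℝ[ε]) : Prop where
  unitary_left : U ∈ Matrix.unitaryGroup (Fin m) ℂ[ε]
  unitary_right : V ∈ Matrix.unitaryGroup (Fin n) ℂ[ε]
  le_rows : t ≤ m
  le_cols : t ≤ n
  pos : ∀ j, 0 < μ j
  antitone : Antitone μ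
  eq_diagonal : Uᴴ * A * V = rectDiagonal μ

/-- The rank of a dual complex matrix: the number `t` of nonzero singular values (appreciable or
infinitesimal) in a singular value decomposition. Every dual complex matrix has such a
decomposition, and `t` is the same for all of them. -/
noncomputable def rank (A : Matrix (Fin m) (Fin n) ℂ[ε]) : ℕ :=
  sInf {t : ℕ | ∃ U V, ∃ μ : Fin t → ℝ[ε], IsSVD A t U V μ}

/-- A family of vectors `x₁, …, xᵣ` with `xᵢ* xⱼ = δᵢⱼ`. -/
def IsOrthonormal {r : ℕ} (x : Fin r → Fin n → ℂ[ε]) : Prop :=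
  ∀ i j, star (x i) ⬝ᵥ x j = if i = j then 1 else 0

/-- The sum `∑ⱼ μⱼ uⱼ vⱼ*`. -/
noncomputable def svdSum {r : ℕ} (μ : Fin r → ℝ[ε]) (u : Fin r → Fin m → ℂ[ε])
    (v : Fin r → Fin n → ℂ[ε]) : Matrix (Fin m) (Fin n) ℂ[ε] :=
  ∑ j, ofDual (μ j) • Matrix.vecMulVec (u j) (star (v j))

end DualComplex

/-!
A dual number `a + b ε` is the one-sided first-order jet at `0` of a real function, and the total
order of the dual numbers is exactly the order of germs at `0⁺`: if `f ≤ g` for all small `s > 0`,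
then the jet of `f` is at most the jet of `g` (`HasRightJet.le`). The dual Frobenius norm of
`A₀ + A₁ ε` is the jet of the ordinary Frobenius norm of `A₀ + s A₁`, in both cases of its
definition (`hasRightJet_frobeniusNorm`). Substituting `s` for `ε` is multiplicative up to `O(s²)`
(`lineAt_mul`), which jets do not see, so inequalities between dual Frobenius norms follow from
inequalities between complex matrices for small real `s > 0`.

Two complex facts are transferred in this way. Multiplication by an isometry or a co-isometry does
not increase the norm (`frobeniusNorm_mul_le`), since at `s` its operator norm is `1 + O(s²)`. And
the Eckart–Young inequality holds for a diagonal matrix with positive decreasing entries against a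
product `C D` with inner dimension at most `k` (`frobeniusNorm_diagonal_tail_le`). With
`A = X Σ Y*` this gives
`‖A - A_k‖ ≤ ‖Σ_tail‖ ≤ ‖Σ - X* B Y‖ = ‖X* (A - B) Y‖ ≤ ‖A - B‖`.

That a matrix `B` of rank at most `k` is such a product requires that `B` has a singular value
decomposition at all (`exists_isSVD`), because the rank is an infimum over its decompositions. One
is obtained by diagonalizing the dual Hermitian matrix `B* B` with first-order perturbation theory
(`exists_spectral`). This yields the appreciable singular values and leaves an infinitesimal
remainder `ε W`, where `W` annihilates the appreciable singular vectors on both sides; a complex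
singular value decomposition of `W` supplies the infinitesimal singular values.
-/

namespace DualComplex

open Filter Topology

/-! ### Components of sums of dual numbers -/

@[simp] theorem fst_sum {R ι : Type*} [CommRing R] (s : Finset ι) (f : ι → R[ε]) :
    (∑ i ∈ s, f i).fst = ∑ i ∈ s, (f i).fst :=
  map_sum (TrivSqZeroExt.fstHom R R R) f s

@[simp] theorem snd_sum {R ι : Type*} [CommRing R] (s : Finset ι) (f : ι → R[ε]) :
    (∑ i ∈ s, f i).snd = ∑ i ∈ s, (f i).snd :=
  map_sum (TrivSqZeroExt.sndHom R R) f s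

/-! ### One-sided first-order jets and the order of dual numbers -/

/-- The dual number `q = a + b ε` is the one-sided jet of `f : ℝ → ℝ` at `0`: `f 0 = a`, and `b`
is the right derivative of `f` at `0`. -/
def HasRightJet (f : ℝ → ℝ) (q : ℝ[ε]) : Prop :=
  f 0 = q.fst ∧ HasDerivWithinAt f q.snd (Set.Ici 0) 0

/-- The total order of the dual numbers is the order of germs at `0⁺`. -/
theorem HasRightJet.le {f g : ℝ → ℝ} {p q : ℝ[ε]} (hf : HasRightJet f p) (hg : HasRightJet g q)
    (h : ∀ᶠ s in 𝓝[>] (0 : ℝ), f s ≤ g s) : p ≤ q := by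
  obtain ⟨hf0, hf⟩ := hf
  obtain ⟨hg0, hg⟩ := hg
  have hle : f 0 ≤ g 0 :=
    le_of_tendsto_of_tendsto
      (hf.continuousWithinAt.mono_left (nhdsWithin_mono _ Set.Ioi_subset_Ici_self))
      (hg.continuousWithinAt.mono_left (nhdsWithin_mono _ Set.Ioi_subset_Ici_self)) h
  rw [DualNumber.le_iff_real]
  rcases hle.lt_or_eq with h0 | h0
  · exact Or.inl (by rwa [← hf0, ← hg0])
  · refine Or.inr ⟨by rw [← hf0, ← hg0, h0], ?_⟩
    rw [hasDerivWithinAt_iff_tendsto_slope, Set.Ici_sdiff_left] at hf hg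
    refine le_of_tendsto_of_tendsto hf hg ?_
    filter_upwards [h, self_mem_nhdsWithin] with s hs hs0
    have hs0 : 0 < s := hs0
    simp only [slope_def_field, h0]
    gcongr

/-- Jets do not see an additive error of second order. -/
theorem HasRightJet.add_mul_sq {f : ℝ → ℝ} {q : ℝ[ε]} (hf : HasRightJet f q) (c : ℝ) :
    HasRightJet (fun s => f s + c * s ^ 2) q := by
  refine ⟨by simpa using hf.1, ?_⟩
  have h : HasDerivWithinAt (fun s : ℝ => c * s ^ 2) (c * (2 * 0)) (Set.Ici 0) 0 := by
    simpa using ((hasDerivAt_pow 2 (0 : ℝ)).const_mul c).hasDerivWithinAt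
  have := hf.2.add h
  simp only [mul_zero, add_zero] at this
  exact this

/-- Jets do not see a relative error of second order. -/
theorem HasRightJet.one_add_mul_sq_mul {f : ℝ → ℝ} {q : ℝ[ε]} (hf : HasRightJet f q) (c : ℝ) :
    HasRightJet (fun s => (1 + c * s ^ 2) * f s) q := by
  refine ⟨by simpa using hf.1, ?_⟩
  have h : HasDerivWithinAt (fun s : ℝ => 1 + c * s ^ 2) (c * (2 * 0)) (Set.Ici 0) 0 := by
    simpa using (((hasDerivAt_pow 2 (0 : ℝ)).const_mul c).const_add 1).hasDerivWithinAt
  have := h.mul hf.2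
  simp only [mul_zero, zero_mul, zero_add, ne_eq, OfNat.ofNat_ne_zero, not_false_eq_true, zero_pow,
    add_zero, one_mul] at this
  exact this

/-! ### The Frobenius norm along the line `s ↦ A₀ + s A₁` -/

section Frob

variable {m n p : Type*} [Fintype m] [Fintype n] [Fintype p]

/-- The Frobenius norm of a complex matrix. -/
noncomputable def frob (M : Matrix m n ℂ) : ℝ := √(∑ i, ∑ j, ‖M i j‖ ^ 2)

theorem frob_nonneg (M : Matrix m n ℂ) : 0 ≤ frob M := Real.sqrt_nonneg _

theorem frob_sq (M : Matrix m n ℂ) : frob M ^ 2 = ∑ i, ∑ j, ‖M i j‖ ^ 2 :=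
  Real.sq_sqrt (by positivity)

section

open scoped Matrix.Norms.Frobenius

theorem frob_eq_norm (M : Matrix m n ℂ) : frob M = ‖M‖ := by
  rw [frob, Matrix.frobenius_norm_def, Real.sqrt_eq_rpow]
  simp

theorem frob_add_le (M N : Matrix m n ℂ) : frob (M + N) ≤ frob M + frob N := by
  simpa only [frob_eq_norm] using norm_add_le M N

theorem frob_smul (c : ℂ) (M : Matrix m n ℂ) : frob (c • M) = ‖c‖ * frob M := by
  simpa only [frob_eq_norm] using norm_smul c M

theorem frob_conjTranspose (M : Matrix m n ℂ) : frob Mᴴ = frob M := by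
  simpa only [frob_eq_norm] using Matrix.frobenius_norm_conjTranspose M

end

theorem frob_eq_zero {M : Matrix m n ℂ} (h : frob M = 0) : M = 0 := by
  have := frob_eq_norm M
  rw [h] at this
  open scoped Matrix.Norms.Frobenius in
  exact norm_eq_zero.mp this.symm

end Frob

variable {m n p : ℕ}

/-- The value at `s` of the line `s ↦ A₀ + s A₁` given by the dual matrix `A₀ + A₁ ε`. -/
noncomputable def lineAt {m n : Type*} (A : Matrix m n ℂ[ε]) (s : ℝ) : Matrix m n ℂ :=
  A.map TrivSqZeroExt.fst + (s : ℂ) • A.map TrivSqZeroExt.snd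

theorem hasDerivAt_norm_sq_line (a b : ℂ) :
    HasDerivAt (fun s : ℝ => ‖a + s * b‖ ^ 2) (2 * (a.re * b.re + a.im * b.im)) 0 := by
  have h1 : HasDerivAt (fun s : ℝ => (a.re + s * b.re) ^ 2 + (a.im + s * b.im) ^ 2)
      (2 * (a.re * b.re + a.im * b.im)) 0 := by
    have e1 := (((hasDerivAt_id (0 : ℝ)).mul_const b.re).const_add a.re).pow 2
    have e2 := (((hasDerivAt_id (0 : ℝ)).mul_const b.im).const_add a.im).pow 2
    convert! e1.add e2 using 1
    simp
    ring
  convert! h1 using 2 with s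
  rw [← Complex.normSq_eq_norm_sq, Complex.normSq_apply]
  simp
  ring

theorem fst_magnitude_sq (q : ℂ[ε]) : (magnitude q ^ 2).fst = ‖q.fst‖ ^ 2 := by
  unfold magnitude
  split_ifs with h
  · simp
  · simp_all

theorem snd_magnitude_sq (q : ℂ[ε]) :
    (magnitude q ^ 2).snd = 2 * (q.fst.re * q.snd.re + q.fst.im * q.snd.im) := by
  unfold magnitude
  split_ifs with h
  · have : ‖q.fst‖ ≠ 0 := by simpa using h
    simp [pow_two]
    field_simp
    ring
  · have : q.fst = 0 := by simpa using h
    simp [pow_two, this]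

/-- The dual Frobenius norm of `A₀ + A₁ ε` is the one-sided jet at `0` of the Frobenius norm
along the line `s ↦ A₀ + s A₁`. -/
theorem hasRightJet_frobeniusNorm (A : Matrix (Fin m) (Fin n) ℂ[ε]) :
    HasRightJet (fun s => frob (lineAt A s)) (frobeniusNorm A) := by
  unfold frobeniusNorm
  split_ifs with h
  · have hpos : 0 < frob (A.map TrivSqZeroExt.fst) :=
      lt_of_le_of_ne (frob_nonneg _) fun h0 => h (frob_eq_zero h0.symm)
    have hfst : (∑ i, ∑ j, magnitude (A i j) ^ 2).fst = frob (A.map TrivSqZeroExt.fst) ^ 2 := by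
      simp [frob_sq, fst_magnitude_sq, -TrivSqZeroExt.fst_pow]
    have hsnd : (∑ i, ∑ j, magnitude (A i j) ^ 2).snd = ∑ i, ∑ j, 2 * ((A i j).fst.re *
        (A i j).snd.re + (A i j).fst.im * (A i j).snd.im) := by
      simp [snd_magnitude_sq, -TrivSqZeroExt.snd_pow]
    have hd : HasDerivAt (fun s : ℝ => ∑ i, ∑ j, ‖lineAt A s i j‖ ^ 2)
        (∑ i, ∑ j, 2 * ((A i j).fst.re * (A i j).snd.re + (A i j).fst.im * (A i j).snd.im)) 0 :=
      HasDerivAt.fun_sum fun i _ => HasDerivAt.fun_sum fun j _ =>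
        hasDerivAt_norm_sq_line (A i j).fst (A i j).snd
    have h0 : ∑ i, ∑ j, ‖lineAt A 0 i j‖ ^ 2 = frob (A.map TrivSqZeroExt.fst) ^ 2 := by
      simp [frob_sq, lineAt]
    have hs := (hd.sqrt (by rw [h0]; positivity)).hasDerivWithinAt (s := Set.Ici 0)
    rw [h0] at hs
    have hq : 0 < (∑ i, ∑ j, magnitude (A i j) ^ 2).fst := by rw [hfst]; positivity
    rw [dualSqrt, if_pos hq, hfst, hsnd]
    refine ⟨?_, ?_⟩
    · simp [lineAt, Real.sqrt_sq hpos.le]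
    · simpa [frob] using hs
  · have h : A.map TrivSqZeroExt.fst = 0 := by simpa using h
    have hl : ∀ s : ℝ, 0 ≤ s →
        frob (lineAt A s) = s * √(∑ i, ∑ j, ‖(A i j).snd‖ ^ 2) := fun s hs => by
      rw [lineAt, h, zero_add, frob_smul]
      simp [abs_of_nonneg hs, frob]
    refine ⟨by simpa using hl 0 le_rfl, ?_⟩
    refine HasDerivWithinAt.congr ?_ (fun s hs => hl s hs) (hl 0 le_rfl)
    simpa using ((hasDerivAt_id (0 : ℝ)).mul_const _).hasDerivWithinAt

/-! ### Dual matrices by components -/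

section Components

variable {m n p : Type*}

theorem ext_components {A B : Matrix m n ℂ[ε]}
    (h0 : A.map TrivSqZeroExt.fst = B.map TrivSqZeroExt.fst)
    (h1 : A.map TrivSqZeroExt.snd = B.map TrivSqZeroExt.snd) : A = B := by
  ext i j
  · exact congrFun (congrFun h0 i) j
  · exact congrFun (congrFun h1 i) j

@[simp] theorem fst_star (q : ℂ[ε]) : (star q).fst = star q.fst := by
  change (TrivSqZeroExt.inl (star q.fst) + TrivSqZeroExt.inr (star q.snd) : ℂ[ε]).fst = _
  simp

@[simp] theorem snd_star (q : ℂ[ε]) : (star q).snd = star q.snd := by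
  change (TrivSqZeroExt.inl (star q.fst) + TrivSqZeroExt.inr (star q.snd) : ℂ[ε]).snd = _
  simp

@[simp] theorem map_fst_mul [Fintype n] (A : Matrix m n ℂ[ε]) (B : Matrix n p ℂ[ε]) :
    (A * B).map TrivSqZeroExt.fst = A.map TrivSqZeroExt.fst * B.map TrivSqZeroExt.fst := by
  ext i j
  simp [Matrix.mul_apply]

@[simp] theorem map_snd_mul [Fintype n] (A : Matrix m n ℂ[ε]) (B : Matrix n p ℂ[ε]) :
    (A * B).map TrivSqZeroExt.snd = A.map TrivSqZeroExt.fst * B.map TrivSqZeroExt.snd +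
      A.map TrivSqZeroExt.snd * B.map TrivSqZeroExt.fst := by
  ext i j
  simp [Matrix.mul_apply, Finset.sum_add_distrib, mul_comm]

@[simp] theorem map_fst_conjTranspose (A : Matrix m n ℂ[ε]) :
    Aᴴ.map TrivSqZeroExt.fst = (A.map TrivSqZeroExt.fst)ᴴ := by
  ext i j
  simp

@[simp] theorem map_snd_conjTranspose (A : Matrix m n ℂ[ε]) :
    Aᴴ.map TrivSqZeroExt.snd = (A.map TrivSqZeroExt.snd)ᴴ := by
  ext i j
  simp

@[simp] theorem map_fst_one [DecidableEq m] :
    (1 : Matrix m m ℂ[ε]).map TrivSqZeroExt.fst = 1 := by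
  ext i j
  simp [Matrix.one_apply, apply_ite TrivSqZeroExt.fst]

@[simp] theorem map_snd_one [DecidableEq m] :
    (1 : Matrix m m ℂ[ε]).map TrivSqZeroExt.snd = 0 := by
  ext i j
  simp [Matrix.one_apply, apply_ite TrivSqZeroExt.snd]

@[simp] theorem map_fst_add (A B : Matrix m n ℂ[ε]) : (A + B).map TrivSqZeroExt.fst =
    A.map TrivSqZeroExt.fst + B.map TrivSqZeroExt.fst := by
  ext i j
  simp

@[simp] theorem map_snd_add (A B : Matrix m n ℂ[ε]) : (A + B).map TrivSqZeroExt.snd =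
    A.map TrivSqZeroExt.snd + B.map TrivSqZeroExt.snd := by
  ext i j
  simp

@[simp] theorem map_fst_sub (A B : Matrix m n ℂ[ε]) : (A - B).map TrivSqZeroExt.fst =
    A.map TrivSqZeroExt.fst - B.map TrivSqZeroExt.fst := by
  ext i j
  simp

@[simp] theorem map_snd_sub (A B : Matrix m n ℂ[ε]) : (A - B).map TrivSqZeroExt.snd =
    A.map TrivSqZeroExt.snd - B.map TrivSqZeroExt.snd := by
  ext i j
  simp

theorem lineAt_sub (A B : Matrix m n ℂ[ε]) (s : ℝ) :
    lineAt (A - B) s = lineAt A s - lineAt B s := by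
  simp only [lineAt, map_fst_sub, map_snd_sub, smul_sub]
  abel

theorem lineAt_conjTranspose (A : Matrix m n ℂ[ε]) (s : ℝ) :
    lineAt Aᴴ s = (lineAt A s)ᴴ := by
  simp [lineAt]

/-- Evaluation along lines is multiplicative up to a second-order error. -/
theorem lineAt_mul [Fintype n] (A : Matrix m n ℂ[ε]) (B : Matrix n p ℂ[ε]) (s : ℝ) :
    lineAt (A * B) s = lineAt A s * lineAt B s -
      ((s : ℂ) ^ 2) • (A.map TrivSqZeroExt.snd * B.map TrivSqZeroExt.snd) := by
  simp only [lineAt, map_fst_mul, map_snd_mul, Matrix.add_mul, Matrix.mul_add, Matrix.smul_mul,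
    Matrix.mul_smul, smul_add, smul_smul, pow_two]
  abel

end Components

/-! ### Isometries and co-isometries do not increase the Frobenius norm -/

section

open scoped Matrix.Norms.L2Operator

theorem frob_mul_le {m n p : Type*} [Fintype m] [Fintype n] [Fintype p] [DecidableEq n]
    (L : Matrix m n ℂ) (N : Matrix n p ℂ) : frob (L * N) ≤ ‖L‖ * frob N := by
  refine abs_le_of_sq_le_sq' ?_ (mul_nonneg (norm_nonneg _) (frob_nonneg _)) |>.2
  rw [mul_pow, frob_sq, frob_sq, Finset.sum_comm, Finset.sum_comm (f := fun i j => ‖N i j‖ ^ 2),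
    Finset.mul_sum]
  refine Finset.sum_le_sum fun j _ => ?_
  have h := Matrix.l2_opNorm_mulVec L (WithLp.toLp 2 fun i => N i j)
  have h2 := pow_le_pow_left₀ (norm_nonneg _) h 2
  rw [mul_pow, EuclideanSpace.norm_sq_eq, EuclideanSpace.norm_sq_eq] at h2
  exact h2

theorem l2_opNorm_one_le (k : Type*) [Fintype k] [DecidableEq k] :
    ‖(1 : Matrix k k ℂ)‖ ≤ 1 := by
  rcases isEmpty_or_nonempty k with h | h
  · simp [Subsingleton.elim (1 : Matrix k k ℂ) 0]
  · exact norm_one.le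

/-- If `L₀ + L₁ ε` is an isometry or a co-isometry over the dual complex numbers, then
`L₀ + s L₁` has operator norm at most `1 + c s²`. -/
theorem exists_norm_lineAt_le {m n : Type*} [Fintype m] [Fintype n] [DecidableEq m]
    [DecidableEq n] (L : Matrix m n ℂ[ε]) (hL : Lᴴ * L = 1 ∨ L * Lᴴ = 1) :
    ∃ c : ℝ, ∀ s : ℝ, ‖lineAt L s‖ ≤ 1 + c * s ^ 2 := by
  have aux : ∀ {x c s : ℝ}, 0 ≤ c → x * x ≤ 1 + s ^ 2 * c → x ≤ 1 + c * s ^ 2 := by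
    intro x c s hc h
    have : 0 ≤ c * s ^ 2 := by positivity
    nlinarith
  rcases hL with hL | hL
  · refine ⟨‖(L.map TrivSqZeroExt.snd)ᴴ * L.map TrivSqZeroExt.snd‖, fun s => ?_⟩
    refine aux (norm_nonneg _) ?_
    have h := lineAt_mul Lᴴ L s
    rw [hL, lineAt_conjTranspose, map_snd_conjTranspose, eq_sub_iff_add_eq] at h
    rw [← Matrix.l2_opNorm_conjTranspose_mul_self, ← h]
    refine (norm_add_le _ _).trans (add_le_add ?_ ?_)
    · simpa [lineAt] using l2_opNorm_one_le _
    · rw [norm_smul]; simp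
  · refine ⟨‖L.map TrivSqZeroExt.snd * (L.map TrivSqZeroExt.snd)ᴴ‖, fun s => ?_⟩
    refine aux (norm_nonneg _) ?_
    have h := lineAt_mul L Lᴴ s
    rw [hL, lineAt_conjTranspose, map_snd_conjTranspose, eq_sub_iff_add_eq] at h
    rw [← Matrix.l2_opNorm_conjTranspose (lineAt L s), ← Matrix.l2_opNorm_conjTranspose_mul_self,
      Matrix.conjTranspose_conjTranspose, ← h]
    refine (norm_add_le _ _).trans (add_le_add ?_ ?_)
    · simpa [lineAt] using l2_opNorm_one_le _
    · rw [norm_smul]; simp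

end

theorem frobeniusNorm_mul_le (L : Matrix (Fin p) (Fin m) ℂ[ε]) (hL : Lᴴ * L = 1 ∨ L * Lᴴ = 1)
    (M : Matrix (Fin m) (Fin n) ℂ[ε]) : frobeniusNorm (L * M) ≤ frobeniusNorm M := by
  obtain ⟨c, hc⟩ := exists_norm_lineAt_le L hL
  refine (hasRightJet_frobeniusNorm (L * M)).le (((hasRightJet_frobeniusNorm M).one_add_mul_sq_mul
    c).add_mul_sq (frob (L.map TrivSqZeroExt.snd * M.map TrivSqZeroExt.snd)))
    (Eventually.of_forall fun s => ?_)
  rw [lineAt_mul, sub_eq_add_neg, ← neg_smul]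
  refine (frob_add_le _ _).trans (add_le_add ?_ ?_)
  · exact (frob_mul_le _ _).trans (mul_le_mul_of_nonneg_right (hc s) (frob_nonneg _))
  · rw [frob_smul, mul_comm]
    simp

theorem frobeniusNorm_conjTranspose_le (M : Matrix (Fin m) (Fin n) ℂ[ε]) :
    frobeniusNorm Mᴴ ≤ frobeniusNorm M :=
  (hasRightJet_frobeniusNorm Mᴴ).le (hasRightJet_frobeniusNorm M) <| Eventually.of_forall fun s =>
    by rw [lineAt_conjTranspose, frob_conjTranspose]

theorem frobeniusNorm_mul_le' (M : Matrix (Fin m) (Fin n) ℂ[ε]) (L : Matrix (Fin n) (Fin p) ℂ[ε])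
    (hL : Lᴴ * L = 1 ∨ L * Lᴴ = 1) : frobeniusNorm (M * L) ≤ frobeniusNorm M := by
  have h := frobeniusNorm_mul_le Lᴴ (by simpa using hL.symm) Mᴴ
  have h1 := frobeniusNorm_conjTranspose_le (Lᴴ * Mᴴ)
  rw [Matrix.conjTranspose_mul, Matrix.conjTranspose_conjTranspose,
    Matrix.conjTranspose_conjTranspose] at h1
  exact h1.trans (h.trans (frobeniusNorm_conjTranspose_le M))

/-! ### Eckart–Young for diagonal matrices -/

/-- A weighted tail sum is at most the sum with fractional weights `1 - pⱼ` of total mass at least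
that of the tail. -/
theorem sum_tail_le {r k : ℕ} (d p : Fin r → ℝ) (hd : Antitone d) (hd0 : ∀ j, 0 ≤ d j)
    (hp0 : ∀ j, 0 ≤ p j) (hp1 : ∀ j, p j ≤ 1) (hp : ∑ j, p j ≤ k) :
    ∑ j : Fin r, (if (j : ℕ) < k then 0 else d j) ≤ ∑ j, d j * (1 - p j) := by
  rcases le_or_gt r k with hrk | hrk
  · have : ∀ j : Fin r, (j : ℕ) < k := fun j => j.2.trans_le hrk
    simp only [this, if_true, Finset.sum_const_zero]
    exact Finset.sum_nonneg fun j _ => mul_nonneg (hd0 j) (by linarith [hp1 j])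
  -- compare each weight with the threshold `t = d k`
  set t := d ⟨k, hrk⟩ with ht
  have key : ∀ j : Fin r, (if (j : ℕ) < k then 0 else d j) ≤
      d j * (1 - p j) + t * (p j - if (j : ℕ) < k then 1 else 0) := by
    intro j
    split_ifs with h
    · have : t ≤ d j := hd (by rw [Fin.le_def]; exact h.le)
      nlinarith [hp1 j]
    · have : d j ≤ t := hd (by rw [Fin.le_def]; exact not_lt.mp h)
      nlinarith [hp0 j]
  have hcard : ∑ j : Fin r, (if (j : ℕ) < k then (1 : ℝ) else 0) = k := by
    rw [Finset.sum_boole]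
    have : (Finset.univ.filter fun j : Fin r => (j : ℕ) < k) = Finset.Iio ⟨k, hrk⟩ := by
      ext j; simp [Fin.lt_def]
    rw [this, Fin.card_Iio]
  refine (Finset.sum_le_sum fun j _ => key j).trans ?_
  rw [Finset.sum_add_distrib, ← Finset.mul_sum, Finset.sum_sub_distrib, hcard]
  have : 0 ≤ t := hd0 _
  nlinarith

/-- The squared lengths of the projections of the standard basis vectors onto a subspace add up to
its dimension. -/
theorem sum_norm_sq_starProjection_single {r : ℕ} (S : Submodule ℂ (EuclideanSpace ℂ (Fin r))) :
    ∑ j, ‖S.starProjection (EuclideanSpace.single j 1)‖ ^ 2 = Module.finrank ℂ S := by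
  let b := stdOrthonormalBasis ℂ S
  have h : ∀ j, ‖S.starProjection (EuclideanSpace.single j 1)‖ ^ 2 =
      ∑ i, ‖((b i : S) : EuclideanSpace ℂ (Fin r)) j‖ ^ 2 := fun j => by
    rw [Submodule.starProjection_apply, ← Submodule.coe_norm, ← b.sum_sq_norm_inner_right]
    refine Finset.sum_congr rfl fun i _ => ?_
    rw [Submodule.inner_orthogonalProjectionOnto_eq_of_mem_left]
    simp [EuclideanSpace.inner_single_right]
  simp_rw [h]
  rw [Finset.sum_comm]
  have hb : ∀ i, ∑ j, ‖((b i : S) : EuclideanSpace ℂ (Fin r)) j‖ ^ 2 = 1 := fun i => by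
    rw [← EuclideanSpace.norm_sq_eq, ← Submodule.coe_norm, b.norm_eq_one, one_pow]
  simp [hb]

/-- Eckart–Young for a diagonal matrix with nonnegative decreasing entries. -/
theorem frob_diagonal_tail_le {r k t : ℕ} (d : Fin r → ℝ) (hd : Antitone d) (hd0 : ∀ j, 0 ≤ d j)
    (C : Matrix (Fin r) (Fin t) ℂ) (D : Matrix (Fin t) (Fin r) ℂ) (ht : t ≤ k) :
    frob (Matrix.diagonal fun j : Fin r => if (j : ℕ) < k then (0 : ℂ) else d j) ≤
      frob (Matrix.diagonal (fun j => (d j : ℂ)) - C * D) := by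
  -- project the columns onto the orthogonal complement of the column space of `C`
  let S : Submodule ℂ (EuclideanSpace ℂ (Fin r)) :=
    Submodule.span ℂ (Set.range fun l : Fin t => WithLp.toLp 2 fun i => C i l)
  have hS : Module.finrank ℂ S ≤ k :=
    (finrank_range_le_card (R := ℂ) _).trans (by simpa using ht)
  let e : Fin r → EuclideanSpace ℂ (Fin r) := fun j => EuclideanSpace.single j 1
  let p : Fin r → ℝ := fun j => ‖S.starProjection (e j)‖ ^ 2
  have hpy : ∀ j, ‖Sᗮ.starProjection (e j)‖ ^ 2 = 1 - p j := fun j => by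
    have := S.norm_sq_eq_add_norm_sq_starProjection (e j)
    have h1 : ‖e j‖ = 1 := by simp [e]
    rw [h1] at this
    simp only [p]
    linarith
  refine abs_le_of_sq_le_sq' ?_ (frob_nonneg _) |>.2
  rw [frob_sq, frob_sq]
  have hL : ∑ i, ∑ j, ‖(Matrix.diagonal fun j : Fin r => if (j : ℕ) < k then (0 : ℂ) else d j) i j‖
      ^ 2 = ∑ j : Fin r, (if (j : ℕ) < k then 0 else d j ^ 2) := by
    refine Finset.sum_congr rfl fun i _ => ?_
    rw [Finset.sum_eq_single i]
    · rw [Matrix.diagonal_apply_eq]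
      split_ifs <;> simp
    · intro j _ hj
      simp [Matrix.diagonal_apply_ne' _ hj]
    · simp
  rw [hL]
  refine (sum_tail_le (fun j => d j ^ 2) p
    (fun i j hij => pow_le_pow_left₀ (hd0 _) (hd hij) 2) (fun j => sq_nonneg _)
    (fun j => sq_nonneg _) (fun j => ?_) ?_).trans ?_
  · linarith [hpy j, sq_nonneg ‖Sᗮ.starProjection (e j)‖]
  · rw [sum_norm_sq_starProjection_single]
    exact_mod_cast hS
  · rw [Finset.sum_comm]
    refine Finset.sum_le_sum fun j _ => ?_
    let c : EuclideanSpace ℂ (Fin r) := WithLp.toLp 2 fun i => (C * D) i j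
    have hc : c ∈ S := by
      have : c = ∑ l, D l j • WithLp.toLp 2 fun i => C i l := by
        ext i
        simp [c, Matrix.mul_apply, mul_comm]
      rw [this]
      exact S.sum_mem fun l _ => S.smul_mem _ (Submodule.subset_span ⟨l, rfl⟩)
    have hproj : Sᗮ.starProjection ((d j : ℂ) • e j - c) = (d j : ℂ) • Sᗮ.starProjection (e j) := by
      rw [map_sub, map_smul, Submodule.starProjection_orthogonal_apply_eq_zero hc, sub_zero]
    have hcol : ‖(d j : ℂ) • e j - c‖ ^ 2 =
        ∑ i, ‖(Matrix.diagonal (fun j => (d j : ℂ)) - C * D) i j‖ ^ 2 := by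
      rw [EuclideanSpace.norm_sq_eq]
      refine Finset.sum_congr rfl fun i _ => ?_
      by_cases hij : i = j <;> simp [e, c, hij]
    rw [← hcol, ← hpy, ← mul_pow]
    refine pow_le_pow_left₀ (mul_nonneg (hd0 j) (norm_nonneg _)) ?_ 2
    calc d j * ‖Sᗮ.starProjection (e j)‖ = ‖Sᗮ.starProjection ((d j : ℂ) • e j - c)‖ := by
          rw [hproj, norm_smul]; simp [abs_of_nonneg (hd0 j)]
      _ ≤ _ := Submodule.norm_starProjection_apply_le _ _

@[simp] theorem fst_ofDual (q : ℝ[ε]) : (ofDual q).fst = (q.fst : ℂ) := by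
  rw [ofDual, TrivSqZeroExt.fst_add, TrivSqZeroExt.fst_inl, TrivSqZeroExt.fst_inr, add_zero]

@[simp] theorem snd_ofDual (q : ℝ[ε]) : (ofDual q).snd = (q.snd : ℂ) := by
  rw [ofDual, TrivSqZeroExt.snd_add, TrivSqZeroExt.snd_inl, TrivSqZeroExt.snd_inr, zero_add]

/-- An inequality of dual numbers persists along the corresponding lines near `0⁺`. -/
theorem eventually_line_le {p q : ℝ[ε]} (h : p ≤ q) :
    ∀ᶠ s in 𝓝[>] (0 : ℝ), p.fst + s * p.snd ≤ q.fst + s * q.snd := by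
  rcases h with h | ⟨h, h'⟩
  · have hp : ContinuousAt (fun s : ℝ => p.fst + s * p.snd) 0 := by fun_prop
    have hq : ContinuousAt (fun s : ℝ => q.fst + s * q.snd) 0 := by fun_prop
    exact ((hp.eventually_lt hq (by simpa using h)).filter_mono nhdsWithin_le_nhds).mono
      fun s hs => hs.le
  · filter_upwards [self_mem_nhdsWithin] with s hs
    have hs : 0 < s := hs
    rw [h]
    nlinarith

/-- Eckart–Young for a diagonal dual matrix. -/
theorem frobeniusNorm_diagonal_tail_le {r k t : ℕ} (μ : Fin r → ℝ[ε]) (hμ : Antitone μ)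
    (hμ_pos : ∀ j, 0 < μ j) (C : Matrix (Fin r) (Fin t) ℂ[ε]) (D : Matrix (Fin t) (Fin r) ℂ[ε])
    (ht : t ≤ k) :
    frobeniusNorm (Matrix.diagonal fun j : Fin r => if (j : ℕ) < k then 0 else ofDual (μ j)) ≤
      frobeniusNorm (Matrix.diagonal (fun j => ofDual (μ j)) - C * D) := by
  refine (hasRightJet_frobeniusNorm _).le ((hasRightJet_frobeniusNorm _).add_mul_sq
    (frob (C.map TrivSqZeroExt.snd * D.map TrivSqZeroExt.snd))) ?_
  have h1 : ∀ᶠ s in 𝓝[>] (0 : ℝ), ∀ i j, i ≤ j →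
      (μ j).fst + s * (μ j).snd ≤ (μ i).fst + s * (μ i).snd := by
    simp only [eventually_all]
    exact fun i j hij => eventually_line_le (hμ hij)
  have h2 : ∀ᶠ s in 𝓝[>] (0 : ℝ), ∀ j, 0 ≤ (μ j).fst + s * (μ j).snd := by
    rw [eventually_all]
    exact fun j => (eventually_line_le (hμ_pos j).le).mono fun s hs => by simpa using hs
  filter_upwards [h1, h2] with s hs1 hs2
  have hEY := frob_diagonal_tail_le (k := k) (fun j => (μ j).fst + s * (μ j).snd)
    (fun i j hij => hs1 i j hij) hs2 (lineAt C s) (lineAt D s) ht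
  have hl : lineAt (Matrix.diagonal fun j : Fin r => if (j : ℕ) < k then 0 else ofDual (μ j)) s =
      Matrix.diagonal fun j : Fin r => if (j : ℕ) < k then (0 : ℂ) else
        (((μ j).fst + s * (μ j).snd : ℝ) : ℂ) := by
    ext i j
    by_cases hij : i = j
    · subst hij
      by_cases hk : (i : ℕ) < k <;> simp [lineAt, hk]
    · simp [lineAt, hij]
  have hr : lineAt (Matrix.diagonal fun j : Fin r => ofDual (μ j)) s =
      Matrix.diagonal fun j : Fin r => (((μ j).fst + s * (μ j).snd : ℝ) : ℂ) := by
    ext i j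
    by_cases hij : i = j
    · subst hij
      simp [lineAt]
    · simp [lineAt, hij]
  rw [hl]
  refine hEY.trans ?_
  have hsplit : Matrix.diagonal (fun j : Fin r => (((μ j).fst + s * (μ j).snd : ℝ) : ℂ)) -
      lineAt C s * lineAt D s = lineAt (Matrix.diagonal (fun j => ofDual (μ j)) - C * D) s +
        (-(s : ℂ) ^ 2) • (C.map TrivSqZeroExt.snd * D.map TrivSqZeroExt.snd) := by
    rw [lineAt_sub, hr, lineAt_mul, neg_smul]
    abel
  rw [hsplit]
  refine (frob_add_le _ _).trans (add_le_add le_rfl ?_)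
  rw [frob_smul, mul_comm]
  simp

/-! ### The spectral theorem for dual Hermitian matrices -/

/-- The dual number `a + b ε`. -/
def dual {R : Type*} (a b : R) : R[ε] := (a, b)

@[simp] theorem fst_dual {R : Type*} (a b : R) : (dual a b).fst = a := rfl

@[simp] theorem snd_dual {R : Type*} (a b : R) : (dual a b).snd = b := rfl

/-- The dual matrix `M₀ + M₁ ε`. -/
def ofParts {m n : Type*} (M₀ M₁ : Matrix m n ℂ) : Matrix m n ℂ[ε] :=
  Matrix.of fun i j => dual (M₀ i j) (M₁ i j)

section

variable {m n : Type*}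

@[simp] theorem map_fst_ofParts (M₀ M₁ : Matrix m n ℂ) :
    (ofParts M₀ M₁).map TrivSqZeroExt.fst = M₀ := rfl

@[simp] theorem map_snd_ofParts (M₀ M₁ : Matrix m n ℂ) :
    (ofParts M₀ M₁).map TrivSqZeroExt.snd = M₁ := rfl

@[simp] theorem map_fst_diagonal_ofDual [DecidableEq n] (μ : n → ℝ[ε]) :
    (Matrix.diagonal fun i => ofDual (μ i)).map TrivSqZeroExt.fst =
      Matrix.diagonal fun i => ((μ i).fst : ℂ) := by
  ext i j
  by_cases h : i = j
  · subst h; simp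
  · simp [h]

@[simp] theorem map_snd_diagonal_ofDual [DecidableEq n] (μ : n → ℝ[ε]) :
    (Matrix.diagonal fun i => ofDual (μ i)).map TrivSqZeroExt.snd =
      Matrix.diagonal fun i => ((μ i).snd : ℂ) := by
  ext i j
  by_cases h : i = j
  · subst h; simp
  · simp [h]

theorem ofDual_mul (p q : ℝ[ε]) : ofDual (p * q) = ofDual p * ofDual q := by
  ext <;> simp

@[simp] theorem ofDual_one : ofDual 1 = 1 := by
  ext <;> simp

@[simp] theorem star_ofDual (q : ℝ[ε]) : star (ofDual q) = ofDual q := by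
  ext <;> simp

end

/-- Given symmetric operators `T` and `R`, there is an orthonormal eigenbasis of `T` that also
diagonalizes the compression of `R` to each eigenspace of `T`. -/
theorem exists_orthonormalBasis_eigen_compression {E : Type*} [NormedAddCommGroup E]
    [InnerProductSpace ℂ E] [FiniteDimensional ℂ E] {n : ℕ} (hn : Module.finrank ℂ E = n)
    {T R : E →ₗ[ℂ] E} (hT : T.IsSymmetric) (hR : R.IsSymmetric) :
    ∃ (b : OrthonormalBasis (Fin n) ℂ E) (l : Fin n → ℝ), (∀ i, T (b i) = (l i : ℂ) • b i) ∧
      ∀ i j, i ≠ j → l i = l j → inner ℂ (b i) (R (b j)) = 0 := by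
  classical
  let A : Module.End.Eigenvalues T → Submodule ℂ E := fun a => Module.End.eigenspace T (a : ℂ)
  let C : ∀ a, A a →ₗ[ℂ] A a := fun a =>
    (A a).orthogonalProjectionOnto.toLinearMap ∘ₗ R ∘ₗ (A a).subtype
  have hC_inner : ∀ a (x y : A a), inner ℂ x (C a y) = inner ℂ (x : E) (R y) := fun a x y =>
    Submodule.inner_orthogonalProjectionOnto_eq_of_mem_left x (R y)
  have hC : ∀ a, (C a).IsSymmetric := fun a x y => by
    rw [hC_inner, ← inner_conj_symm, hC_inner, inner_conj_symm, hR]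
  let w : ∀ a, OrthonormalBasis (Fin (Module.finrank ℂ (A a))) ℂ (A a) := fun a =>
    (hC a).eigenvectorBasis rfl
  let c := hT.direct_sum_isInternal.collectedOrthonormalBasis hT.orthogonalFamily_eigenspaces' w
  have hc : ∀ x, c x = (w x.1 x.2 : E) := fun x => by
    simp [c, DirectSum.IsInternal.collectedOrthonormalBasis, A]
  have hcT : ∀ x, T (c x) = (x.1 : ℂ) • c x := fun x => by
    rw [hc]
    exact Module.End.mem_eigenspace_iff.mp (w x.1 x.2).2
  have hcard : Fintype.card (Σ a, Fin (Module.finrank ℂ (A a))) = n := by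
    rw [← Module.finrank_eq_card_basis c.toBasis, hn]
  let e := Fintype.equivFinOfCardEq hcard
  have hreal : ∀ a : Module.End.Eigenvalues T, (((a : ℂ).re : ℝ) : ℂ) = a := fun a =>
    Complex.conj_eq_iff_re.mp (hT.conj_eigenvalue_eq_self a.2)
  refine ⟨c.reindex e, fun i => ((e.symm i).1 : ℂ).re, fun i => ?_, fun i j hij hl => ?_⟩
  · rw [OrthonormalBasis.reindex_apply, hcT, hreal]
  · rw [OrthonormalBasis.reindex_apply, OrthonormalBasis.reindex_apply]
    have hne : e.symm i ≠ e.symm j := fun h => hij (e.symm.injective h)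
    have haa : (e.symm i).1 = (e.symm j).1 := by
      have h : (((e.symm i).1 : ℂ).re : ℂ) = (((e.symm j).1 : ℂ).re : ℂ) := by
        exact_mod_cast hl
      rw [hreal, hreal] at h
      exact Subtype.ext h
    generalize e.symm i = x at *
    generalize e.symm j = y at *
    obtain ⟨a, x⟩ := x
    obtain ⟨a', y⟩ := y
    obtain rfl : a = a' := haa
    rw [hc, hc, ← hC_inner, show C a (w a y) = _ from (hC a).apply_eigenvectorBasis rfl y,
      inner_smul_right, (w a).inner_eq_zero (fun h => hne (congrArg (Sigma.mk a) h)), mul_zero]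

/-- The matrix form of `exists_orthonormalBasis_eigen_compression`. -/
theorem exists_matrix_eigen_compression {n : ℕ} {H K : Matrix (Fin n) (Fin n) ℂ}
    (hH : H.IsHermitian) (hK : K.IsHermitian) :
    ∃ (V : Matrix (Fin n) (Fin n) ℂ) (l : Fin n → ℝ), Vᴴ * V = 1 ∧
      H * V = V * Matrix.diagonal (fun i => (l i : ℂ)) ∧
      ∀ i j, i ≠ j → l i = l j → (Vᴴ * K * V) i j = 0 := by
  obtain ⟨b, l, hb, hbl⟩ := exists_orthonormalBasis_eigen_compression
    (E := EuclideanSpace ℂ (Fin n)) finrank_euclideanSpace_fin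
    (Matrix.isSymmetric_toEuclideanLin_iff.mpr hH)
    (Matrix.isSymmetric_toEuclideanLin_iff.mpr hK)
  refine ⟨Matrix.of fun i j => b j i, l, ?_, ?_, fun i j hij hl => ?_⟩
  · ext i j
    have := b.inner_eq_ite i j
    simpa [Matrix.mul_apply, Matrix.one_apply, PiLp.inner_apply, mul_comm] using this
  · ext i j
    have := congrArg (fun x : EuclideanSpace ℂ (Fin n) => x i) (hb j)
    rw [Matrix.mul_diagonal]
    simpa [Matrix.mul_apply, Matrix.toLpLin_apply, Matrix.mulVec, dotProduct, mul_comm] using this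
  · have := hbl i j hij hl
    rw [Matrix.mul_assoc]
    simpa [Matrix.mul_apply, Matrix.toLpLin_apply, Matrix.mulVec, dotProduct, PiLp.inner_apply,
      mul_comm] using this

/-- A dual Hermitian matrix is unitarily diagonalizable, with dual number eigenvalues. -/
theorem exists_spectral {n : ℕ} (G : Matrix (Fin n) (Fin n) ℂ[ε]) (hG : Gᴴ = G) :
    ∃ (Y : Matrix (Fin n) (Fin n) ℂ[ε]) (Λ : Fin n → ℝ[ε]), Yᴴ * Y = 1 ∧
      G * Y = Y * Matrix.diagonal (fun i => ofDual (Λ i)) := by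
  have hH : (G.map TrivSqZeroExt.fst).IsHermitian := by
    rw [Matrix.IsHermitian, ← map_fst_conjTranspose, hG]
  have hK : (G.map TrivSqZeroExt.snd).IsHermitian := by
    rw [Matrix.IsHermitian, ← map_snd_conjTranspose, hG]
  obtain ⟨V, l, hV, hHV, hKV⟩ := exists_matrix_eigen_compression hH hK
  have hV' : V * Vᴴ = 1 := mul_eq_one_comm.mp hV
  set M := Vᴴ * G.map TrivSqZeroExt.snd * V with hM
  have hMh : Mᴴ = M := by
    rw [hM, Matrix.conjTranspose_mul, Matrix.conjTranspose_mul, hK.eq,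
      Matrix.conjTranspose_conjTranspose, Matrix.mul_assoc]
  have hMs : ∀ i j, star (M j i) = M i j := fun i j => congrFun (congrFun hMh i) j
  -- first-order perturbation of the eigenvectors, expressed in the eigenbasis
  let Z : Matrix (Fin n) (Fin n) ℂ :=
    Matrix.of fun i j => if l i = l j then 0 else M i j / ((l j : ℂ) - l i)
  have hZ : Zᴴ = -Z := by
    ext i j
    simp only [Z, Matrix.conjTranspose_apply, Matrix.of_apply, Matrix.neg_apply]
    by_cases h : l i = l j
    · simp [h]
    · rw [if_neg h, if_neg (Ne.symm h), star_div₀, hMs, ← div_neg]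
      simp
  have hsyl : Matrix.diagonal (fun i => (l i : ℂ)) * Z + M =
      Matrix.diagonal (fun i => ((M i i).re : ℂ)) + Z * Matrix.diagonal (fun i => (l i : ℂ)) := by
    ext i j
    simp only [Matrix.add_apply, Matrix.diagonal_mul, Matrix.mul_diagonal, Z, Matrix.of_apply]
    by_cases hij : i = j
    · subst hij
      simpa using (Complex.conj_eq_iff_re.mp (hMs i i)).symm
    · rw [Matrix.diagonal_apply_ne _ hij]
      by_cases h : l i = l j
      · simp [h, hKV i j hij h]
      · have : (l j : ℂ) - l i ≠ 0 := sub_ne_zero.mpr fun h' => h (by exact_mod_cast h'.symm)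
        rw [if_neg h]
        field_simp
        ring
  refine ⟨ofParts V (V * Z), fun i => dual (l i) (M i i).re, ext_components ?_ ?_,
    ext_components ?_ ?_⟩
  · simp [hV]
  · simp only [map_snd_mul, map_snd_conjTranspose, map_fst_conjTranspose, map_fst_ofParts,
      map_snd_ofParts, map_snd_one, Matrix.conjTranspose_mul, hZ]
    rw [← Matrix.mul_assoc, hV, Matrix.mul_assoc, hV]
    simp
  · simp only [map_fst_mul, map_fst_ofParts, map_fst_diagonal_ofDual]
    exact hHV
  · simp only [map_snd_mul, map_fst_ofParts, map_snd_ofParts, map_fst_diagonal_ofDual,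
      map_snd_diagonal_ofDual]
    have hKVM : G.map TrivSqZeroExt.snd * V = V * M := by
      rw [hM, Matrix.mul_assoc, ← Matrix.mul_assoc, hV', Matrix.one_mul]
    rw [← Matrix.mul_assoc, hHV, hKVM, Matrix.mul_assoc, Matrix.mul_assoc, ← Matrix.mul_add,
      ← Matrix.mul_add, hsyl]
    rfl

/-! ### The appreciable singular values -/

/-- A dual number with positive standard part has a square root that is invertible and again has
positive standard part. -/
theorem exists_sqrt_and_inv {q : ℝ[ε]} (hq : 0 < q.fst) :
    ∃ μ ρ : ℝ[ε], 0 < μ.fst ∧ μ * μ = q ∧ ρ * μ = 1 := by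
  have h := Real.sqrt_pos.mpr hq
  have h2 := Real.mul_self_sqrt hq.le
  refine ⟨dual (√q.fst) (q.snd / (2 * √q.fst)),
    dual (√q.fst)⁻¹ (-(q.snd / (2 * √q.fst)) / (√q.fst) ^ 2), h, ?_, ?_⟩
  · refine TrivSqZeroExt.ext h2 ?_
    simp only [TrivSqZeroExt.snd_mul, fst_dual, snd_dual, smul_eq_mul, MulOpposite.smul_eq_mul_unop,
      MulOpposite.unop_op]
    field_simp
    ring
  · refine TrivSqZeroExt.ext (inv_mul_cancel₀ h.ne') ?_
    simp only [TrivSqZeroExt.snd_mul, fst_dual, snd_dual, smul_eq_mul, MulOpposite.smul_eq_mul_unop,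
      MulOpposite.unop_op, TrivSqZeroExt.snd_one]
    field_simp
    ring

/-- The appreciable part of the singular value decomposition of a dual matrix. The remainder is
infinitesimal, and its coefficient annihilates the standard parts of the appreciable singular
vectors on both sides. -/
theorem exists_appreciable_svd {m n : ℕ} (B : Matrix (Fin m) (Fin n) ℂ[ε]) :
    ∃ (p : Fin n → Prop) (_ : DecidablePred p) (X : Matrix (Fin m) (Subtype p) ℂ[ε])
      (Y : Matrix (Fin n) (Subtype p) ℂ[ε]) (μ : Subtype p → ℝ[ε]) (W : Matrix (Fin m) (Fin n) ℂ),
      Xᴴ * X = 1 ∧ Yᴴ * Y = 1 ∧ (∀ i, 0 < (μ i).fst) ∧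
      (X.map TrivSqZeroExt.fst)ᴴ * W = 0 ∧ W * Y.map TrivSqZeroExt.fst = 0 ∧
      B = X * Matrix.diagonal (fun i => ofDual (μ i)) * Yᴴ + ofParts 0 W := by
  classical
  obtain ⟨Y, Λ, hY, hGY⟩ := exists_spectral (Bᴴ * B) (by simp)
  have hY' : Y * Yᴴ = 1 := mul_eq_one_comm.mp hY
  -- the columns of `Z = B Y` are orthogonal, with squared lengths `Λ`
  set Z := B * Y with hZdef
  have hZ : Zᴴ * Z = Matrix.diagonal fun i => ofDual (Λ i) := by
    rw [hZdef, Matrix.conjTranspose_mul, Matrix.mul_assoc, ← Matrix.mul_assoc Bᴴ, hGY,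
      ← Matrix.mul_assoc, hY, Matrix.one_mul]
  have hBZ : B = Z * Yᴴ := by rw [hZdef, Matrix.mul_assoc, hY', Matrix.mul_one]
  set Z₀ := Z.map TrivSqZeroExt.fst with hZ₀
  set Z₁ := Z.map TrivSqZeroExt.snd with hZ₁
  set Y₀ := Y.map TrivSqZeroExt.fst with hY₀
  have hfst : Z₀ᴴ * Z₀ = Matrix.diagonal fun i => ((Λ i).fst : ℂ) := by
    simpa using congrArg (fun M => M.map TrivSqZeroExt.fst) hZ
  have hsnd : Z₀ᴴ * Z₁ + Z₁ᴴ * Z₀ = Matrix.diagonal fun i => ((Λ i).snd : ℂ) := by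
    simpa using congrArg (fun M => M.map TrivSqZeroExt.snd) hZ
  have hY₀' : Y₀ᴴ * Y₀ = 1 := by
    simpa using congrArg (fun M => M.map TrivSqZeroExt.fst) hY
  have hsum : ∀ i, ∑ k, ‖Z₀ k i‖ ^ 2 = (Λ i).fst := fun i => by
    have := congrFun (congrFun hfst i) i
    simp only [Matrix.mul_apply, Matrix.conjTranspose_apply, Matrix.diagonal_apply_eq,
      RCLike.star_def, Complex.conj_mul'] at this
    exact_mod_cast this
  let p : Fin n → Prop := fun i => 0 < (Λ i).fst
  have hcol : ∀ i, ¬ p i → ∀ k, Z₀ k i = 0 := fun i hi k => by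
    have h0 : ∑ k, ‖Z₀ k i‖ ^ 2 = 0 :=
      le_antisymm ((hsum i).trans_le (not_lt.mp hi)) (by positivity)
    have := (Finset.sum_eq_zero_iff_of_nonneg fun _ _ => by positivity).mp h0 k (Finset.mem_univ _)
    simpa using this
  choose μ ρ hμ_pos hμ hρ using fun i : Subtype p => exists_sqrt_and_inv i.2
  let N : Matrix (Fin n) (Fin n) ℂ := Matrix.diagonal fun i => if p i then 0 else 1
  have hZN : Z₀ * N = 0 := by
    ext k i
    by_cases h : p i
    · simp [N, h]
    · simp [N, h, hcol i h k]
  let X : Matrix (Fin m) (Subtype p) ℂ[ε] := Matrix.of fun k i => Z k i * ofDual (ρ i)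
  let Y' : Matrix (Fin n) (Subtype p) ℂ[ε] := Matrix.of fun k i => Y k i
  refine ⟨p, Classical.decPred p, X, Y', μ, Z₁ * N * Y₀ᴴ, ?_, ?_, hμ_pos, ?_, ?_, ?_⟩
  · ext1 i j
    have h := congrFun (congrFun hZ i) j
    have h1 : (Xᴴ * X) i j = ofDual (ρ i) * ofDual (ρ j) * (Zᴴ * Z) i j := by
      simp only [Matrix.mul_apply, X, Matrix.conjTranspose_apply, Matrix.of_apply, star_mul',
        star_ofDual, Finset.mul_sum]
      exact Finset.sum_congr rfl fun k _ => by ring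
    rw [h1, h]
    by_cases hij : i = j
    · subst hij
      rw [Matrix.diagonal_apply_eq, Matrix.one_apply_eq, ← hμ, ← ofDual_mul, ← ofDual_mul,
        mul_mul_mul_comm, hρ, one_mul, ofDual_one]
    · rw [Matrix.diagonal_apply_ne _ (fun h => hij (Subtype.ext h)), mul_zero,
        Matrix.one_apply_ne hij]
  · ext1 i j
    have h := congrFun (congrFun hY i) j
    rw [Matrix.one_apply] at h
    simp only [Subtype.ext_iff, Matrix.one_apply]
    rw [← h]
    rfl
  · have h1 : Z₀ᴴ * Z₁ * N = Matrix.diagonal fun i => ((Λ i).snd : ℂ) * if p i then 0 else 1 := by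
      rw [← Matrix.diagonal_mul_diagonal, ← hsnd, Matrix.add_mul]
      change _ = _ * N + _ * N
      rw [Matrix.mul_assoc Z₁ᴴ, hZN, Matrix.mul_zero, add_zero]
    ext i j
    have h2 : ((X.map TrivSqZeroExt.fst)ᴴ * (Z₁ * N * Y₀ᴴ)) i j =
        ((ρ i).fst : ℂ) * ((Z₀ᴴ * Z₁ * N) * Y₀ᴴ) i j := by
      rw [Matrix.mul_assoc Z₀ᴴ, Matrix.mul_assoc Z₀ᴴ, Matrix.mul_apply, Matrix.mul_apply,
        Finset.mul_sum]
      refine Finset.sum_congr rfl fun k _ => ?_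
      simp [X, Z₀]
      ring
    rw [h2, h1, Matrix.diagonal_mul, if_pos i.2]
    simp
  · have h1 : Z₁ * N * Y₀ᴴ * Y₀ = Z₁ * N := by rw [Matrix.mul_assoc, hY₀', Matrix.mul_one]
    ext i j
    have h2 : (Z₁ * N * Y₀ᴴ * Y'.map TrivSqZeroExt.fst) i j = (Z₁ * N * Y₀ᴴ * Y₀) i j := rfl
    rw [h2, h1, Matrix.mul_diagonal, if_pos j.2]
    simp
  · have h1 : X * Matrix.diagonal (fun i => ofDual (μ i)) * Y'ᴴ =
        Z * (Matrix.diagonal fun i => if p i then (1 : ℂ[ε]) else 0) * Yᴴ := by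
      ext1 k l
      simp only [Matrix.mul_apply (N := Yᴴ), Matrix.mul_apply (N := Y'ᴴ), Matrix.mul_diagonal]
      rw [← Fintype.sum_subtype_add_sum_subtype p]
      have hz : ∑ i : {x // ¬ p x}, Z k i * (if p i then (1 : ℂ[ε]) else 0) * Yᴴ i l = 0 :=
        Finset.sum_eq_zero fun i _ => by rw [if_neg i.2]; simp
      rw [hz, add_zero]
      refine Finset.sum_congr rfl fun i _ => ?_
      rw [if_pos i.2, mul_one]
      simp only [X, Matrix.of_apply, mul_assoc, ← ofDual_mul, hρ, ofDual_one, one_mul]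
      rfl
    have h2 : Z * (Matrix.diagonal fun i => if p i then (0 : ℂ[ε]) else 1) * Yᴴ =
        ofParts 0 (Z₁ * N * Y₀ᴴ) := by
      have hN0 : (Matrix.diagonal fun i => if p i then (0 : ℂ[ε]) else 1).map TrivSqZeroExt.fst
          = N := by
        ext i j
        by_cases hij : i = j
        · subst hij
          by_cases h : p i <;> simp [N, h]
        · simp [N, hij]
      have hN1 : (Matrix.diagonal fun i => if p i then (0 : ℂ[ε]) else 1).map TrivSqZeroExt.snd
          = 0 := by
        ext i j
        by_cases hij : i = j
        · subst hij
          by_cases h : p i <;> simp [h]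
        · simp [hij]
      refine ext_components ?_ ?_
      · rw [map_fst_mul, map_fst_mul, hN0, hZN]
        simp
      · rw [map_snd_mul, map_fst_mul, map_snd_mul, hN0, hN1, hZN]
        simp [Z₁, Y₀]
    rw [h1, ← h2, ← Matrix.add_mul, ← Matrix.mul_add, Matrix.diagonal_add, hBZ]
    congr 1
    have : (fun i => (if p i then (1 : ℂ[ε]) else 0) + if p i then 0 else 1) = fun _ => 1 := by
      funext i
      split_ifs <;> simp
    rw [this, Matrix.diagonal_one, Matrix.mul_one]

/-! ### Extending dual orthonormal families -/

section Lift

variable {m ι κ : Type*} [Fintype m] [Fintype ι]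

/-- The dual projection of a complex matrix `P` onto the orthogonal complement of the columns of
the dual isometry `X`. -/
def orthLift (X : Matrix m ι ℂ[ε]) (P : Matrix m κ ℂ) : Matrix m κ ℂ[ε] :=
  ofParts P 0 - X * (Xᴴ * ofParts P 0)

theorem conjTranspose_mul_orthLift [DecidableEq ι] {X : Matrix m ι ℂ[ε]} (hX : Xᴴ * X = 1)
    (P : Matrix m κ ℂ) :
    Xᴴ * orthLift X P = 0 := by
  rw [orthLift, Matrix.mul_sub, ← Matrix.mul_assoc, hX, Matrix.one_mul, sub_self]

theorem map_fst_orthLift {X : Matrix m ι ℂ[ε]} {P : Matrix m κ ℂ}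
    (hXP : (X.map TrivSqZeroExt.fst)ᴴ * P = 0) : (orthLift X P).map TrivSqZeroExt.fst = P := by
  simp [orthLift, hXP]

/-- If the columns of `P` are orthonormal and orthogonal to the standard parts of the columns of
`X`, then the projections are still orthonormal: the correction is quadratic in an infinitesimal. -/
theorem conjTranspose_orthLift_mul_orthLift [DecidableEq ι] [DecidableEq κ]
    {X : Matrix m ι ℂ[ε]} (hX : Xᴴ * X = 1) {P : Matrix m κ ℂ} (hP : Pᴴ * P = 1)
    (hXP : (X.map TrivSqZeroExt.fst)ᴴ * P = 0) :
    (orthLift X P)ᴴ * orthLift X P = 1 := by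
  have h1 : (orthLift X P)ᴴ * orthLift X P = (ofParts P 0)ᴴ * orthLift X P := by
    conv_lhs => rw [orthLift, Matrix.conjTranspose_sub, Matrix.sub_mul, Matrix.conjTranspose_mul,
      Matrix.mul_assoc _ Xᴴ, ← orthLift, conjTranspose_mul_orthLift hX]
    simp
  have hPX : Pᴴ * X.map TrivSqZeroExt.fst = 0 := by
    simpa using congrArg Matrix.conjTranspose hXP
  rw [h1, orthLift, Matrix.mul_sub, ← Matrix.mul_assoc]
  refine ext_components ?_ ?_
  · simp [hXP, hP]
  · simp [hXP, hPX]

end Lift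

theorem fromCols_isometry {m ι κ : Type*} [Fintype m] [DecidableEq ι]
    [DecidableEq κ] {X : Matrix m ι ℂ[ε]} {P : Matrix m κ ℂ[ε]} (hX : Xᴴ * X = 1)
    (hP : Pᴴ * P = 1) (hXP : Xᴴ * P = 0) :
    (Matrix.fromCols X P)ᴴ * Matrix.fromCols X P = 1 := by
  have hPX : Pᴴ * X = 0 := by simpa using congrArg Matrix.conjTranspose hXP
  rw [Matrix.conjTranspose_fromCols_eq_fromRows_conjTranspose, Matrix.fromRows_mul_fromCols,
    hX, hP, hXP, hPX, Matrix.fromBlocks_one]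

/-! ### Thin and full singular value decompositions -/

/-- Every dual matrix is a sum `∑ᵢ μᵢ xᵢ yᵢ*` with orthonormal `xᵢ`, orthonormal `yᵢ`, and positive
dual numbers `μᵢ`. -/
theorem exists_thin_svd {m n : ℕ} (B : Matrix (Fin m) (Fin n) ℂ[ε]) :
    ∃ (ι : Type) (_ : Fintype ι) (_ : DecidableEq ι) (X : Matrix (Fin m) ι ℂ[ε])
      (Y : Matrix (Fin n) ι ℂ[ε]) (μ : ι → ℝ[ε]),
      Xᴴ * X = 1 ∧ Yᴴ * Y = 1 ∧ (∀ i, 0 < μ i) ∧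
      B = X * Matrix.diagonal (fun i => ofDual (μ i)) * Yᴴ := by
  obtain ⟨p, _, X, Y, μ, W, hX, hY, hμ, hXW, hWY, hB⟩ := exists_appreciable_svd B
  -- the complex singular value decomposition of the infinitesimal remainder
  obtain ⟨q, _, P', Q', τ', W', hP', hQ', hτ', -, -, hW'⟩ := exists_appreciable_svd (ofParts W 0)
  obtain ⟨P, hPdef⟩ : ∃ P, P = P'.map TrivSqZeroExt.fst := ⟨_, rfl⟩
  obtain ⟨Q, hQdef⟩ : ∃ Q, Q = Q'.map TrivSqZeroExt.fst := ⟨_, rfl⟩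
  obtain ⟨τ, hτdef⟩ : ∃ τ : Subtype q → ℝ, ∀ i, τ i = (τ' i).fst := ⟨_, fun _ => rfl⟩
  have hP : Pᴴ * P = 1 := by
    simpa [hPdef] using congrArg (fun M => M.map TrivSqZeroExt.fst) hP'
  have hQ : Qᴴ * Q = 1 := by
    simpa [hQdef] using congrArg (fun M => M.map TrivSqZeroExt.fst) hQ'
  have hτ : ∀ i, 0 < τ i := fun i => by rw [hτdef]; exact hτ' i
  have hW : W = P * Matrix.diagonal (fun i => (τ i : ℂ)) * Qᴴ := by
    simpa [hPdef, hQdef, hτdef] using congrArg (fun M => M.map TrivSqZeroExt.fst) hW'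
  have hinv :
      Matrix.diagonal (fun i => (τ i : ℂ)) * Matrix.diagonal (fun i => (τ i : ℂ)⁻¹) = 1 := by
    rw [Matrix.diagonal_mul_diagonal, ← Matrix.diagonal_one]
    congr 1
    funext i
    exact mul_inv_cancel₀ (by exact_mod_cast (hτ i).ne')
  have hXP : (X.map TrivSqZeroExt.fst)ᴴ * P = 0 := by
    have h : P = W * Q * Matrix.diagonal (fun i => (τ i : ℂ)⁻¹) := by
      rw [hW, Matrix.mul_assoc _ Qᴴ, hQ, Matrix.mul_one, Matrix.mul_assoc, hinv, Matrix.mul_one]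
    rw [h, ← Matrix.mul_assoc, ← Matrix.mul_assoc, hXW]
    simp
  have hYQ : (Y.map TrivSqZeroExt.fst)ᴴ * Q = 0 := by
    have h : Qᴴ = Matrix.diagonal (fun i => (τ i : ℂ)⁻¹) * (Pᴴ * W) := by
      rw [hW, ← Matrix.mul_assoc Pᴴ, ← Matrix.mul_assoc Pᴴ, hP, Matrix.one_mul,
        ← Matrix.mul_assoc, mul_eq_one_comm.mp hinv, Matrix.one_mul]
    have h2 : Qᴴ * Y.map TrivSqZeroExt.fst = 0 := by
      rw [h, Matrix.mul_assoc, Matrix.mul_assoc, hWY]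
      simp
    simpa using congrArg Matrix.conjTranspose h2
  refine ⟨Subtype p ⊕ Subtype q, inferInstance, inferInstance, Matrix.fromCols X (orthLift X P),
    Matrix.fromCols Y (orthLift Y Q), Sum.elim μ fun i => dual 0 (τ i),
    fromCols_isometry hX (conjTranspose_orthLift_mul_orthLift hX hP hXP)
      (conjTranspose_mul_orthLift hX P),
    fromCols_isometry hY (conjTranspose_orthLift_mul_orthLift hY hQ hYQ)
      (conjTranspose_mul_orthLift hY Q),
    ?_, ?_⟩
  · rintro (i | i)
    · exact lt_of_le_not_ge (Or.inl (hμ i)) fun h => by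
        rcases h with h | ⟨h, -⟩
        · exact lt_asymm h (hμ i)
        · exact (hμ i).ne' h
    · refine lt_of_le_not_ge (Or.inr ⟨rfl, (hτ i).le⟩) fun h => ?_
      rcases h with h | ⟨-, h⟩
      · exact lt_irrefl _ h
      · exact (hτ i).not_ge h
  · have hdiag : Matrix.diagonal (fun i => ofDual (Sum.elim μ (fun i => dual 0 (τ i)) i)) =
        Matrix.fromBlocks (Matrix.diagonal fun i => ofDual (μ i)) 0 0
          (Matrix.diagonal fun i => ofDual (dual 0 (τ i))) := by
      rw [Matrix.fromBlocks_diagonal]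
      congr 1
      funext i
      cases i <;> rfl
    have hεW : ofParts 0 W = orthLift X P * (Matrix.diagonal fun i => ofDual (dual 0 (τ i))) *
        (orthLift Y Q)ᴴ := by
      refine ext_components ?_ ?_
      · simp
      · simp [map_fst_orthLift hXP, map_fst_orthLift hYQ, hW]
    rw [hdiag, Matrix.conjTranspose_fromCols_eq_fromRows_conjTranspose,
      Matrix.fromCols_mul_fromBlocks, Matrix.fromCols_mul_fromRows]
    simp only [Matrix.mul_zero, add_zero, zero_add]
    rw [← hεW]
    exact hB

/-- Complete dual orthonormal columns to a dual unitary matrix. -/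
theorem exists_unitary_completion {m t : ℕ} (X : Matrix (Fin m) (Fin t) ℂ[ε]) (hX : Xᴴ * X = 1) :
    ∃ (_ : t ≤ m) (U : Matrix (Fin m) (Fin m) ℂ[ε]), U ∈ Matrix.unitaryGroup (Fin m) ℂ[ε] ∧
      ∀ (i j : Fin m) (h : (j : ℕ) < t), U i j = X i ⟨j, h⟩ := by
  -- extend the standard parts to an orthonormal basis, then project the new vectors
  have hX0 : (X.map TrivSqZeroExt.fst)ᴴ * X.map TrivSqZeroExt.fst = 1 := by
    simpa using congrArg (fun M => M.map TrivSqZeroExt.fst) hX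
  let x : Fin t → EuclideanSpace ℂ (Fin m) := fun l => WithLp.toLp 2 fun i => (X i l).fst
  have hx : Orthonormal ℂ x := by
    rw [orthonormal_iff_ite]
    intro i j
    have := congrFun (congrFun hX0 i) j
    simpa [Matrix.mul_apply, Matrix.one_apply, PiLp.inner_apply, x, mul_comm] using this
  have htm : t ≤ m := by
    simpa using hx.linearIndependent.fintype_card_le_finrank
  let w : Fin m → EuclideanSpace ℂ (Fin m) := fun j => if h : (j : ℕ) < t then x ⟨j, h⟩ else 0
  obtain ⟨b, hb⟩ := Orthonormal.exists_orthonormalBasis_extension_of_card_eq (𝕜 := ℂ)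
    (E := EuclideanSpace ℂ (Fin m)) (ι := Fin m) (by simp) (v := w) (s := {j | (j : ℕ) < t}) (by
      rw [orthonormal_iff_ite] at hx ⊢
      intro i j
      have := hx ⟨i, i.2⟩ ⟨j, j.2⟩
      have hi : (i : ℕ) < t := i.2
      have hj : (j : ℕ) < t := j.2
      simpa [Set.domRestrict, w, hi, hj, Subtype.ext_iff, Fin.ext_iff] using this)
  have hbx : ∀ l : Fin t, b (Fin.castLE htm l) = x l := fun l => by
    rw [hb _ l.2]
    exact dif_pos l.2
  let P : Matrix (Fin m) {j : Fin m // ¬ (j : ℕ) < t} ℂ := Matrix.of fun i j => b j i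
  have hP : Pᴴ * P = 1 := by
    ext i j
    have := b.inner_eq_ite i j
    simpa [Matrix.mul_apply, Matrix.one_apply, PiLp.inner_apply, P, mul_comm, Subtype.ext_iff]
      using this
  have hXP : (X.map TrivSqZeroExt.fst)ᴴ * P = 0 := by
    ext l j
    have hne : Fin.castLE htm l ≠ j := fun h => j.2 (by rw [← h]; exact l.2)
    have := b.inner_eq_zero hne
    rw [hbx] at this
    simpa [Matrix.mul_apply, PiLp.inner_apply, P, x, mul_comm] using this
  have hUU := fromCols_isometry hX (conjTranspose_orthLift_mul_orthLift hX hP hXP)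
    (conjTranspose_mul_orthLift hX P)
  let f : Fin m → Fin t ⊕ {j : Fin m // ¬ (j : ℕ) < t} := fun j =>
    if h : (j : ℕ) < t then Sum.inl ⟨j, h⟩ else Sum.inr ⟨j, h⟩
  have hf : Function.Injective f := by
    intro i j hij
    by_cases hi : (i : ℕ) < t <;> by_cases hj : (j : ℕ) < t <;>
      simp [f, hi, hj, Fin.ext_iff] at hij ⊢
    · exact hij
    · exact hij
  refine ⟨htm, (Matrix.fromCols X (orthLift X P)).submatrix id f, ?_, fun i j h => ?_⟩
  · rw [Matrix.mem_unitaryGroup_iff']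
    ext1 i j
    have := congrFun (congrFun hUU (f i)) (f j)
    simp only [Matrix.one_apply, hf.eq_iff] at this
    rw [Matrix.one_apply, ← this]
    rfl
  · simp [f, h]

/-- Every dual complex matrix has a singular value decomposition: sort the positive terms of a thin
decomposition and complete its singular vectors to unitary matrices. -/
theorem exists_isSVD {m n : ℕ} (B : Matrix (Fin m) (Fin n) ℂ[ε]) :
    ∃ (t : ℕ) (U : Matrix (Fin m) (Fin m) ℂ[ε]) (V : Matrix (Fin n) (Fin n) ℂ[ε])
      (μ : Fin t → ℝ[ε]), IsSVD B t U V μ := by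
  obtain ⟨ι, _, _, X, Y, μ, hX, hY, hμ, hB⟩ := exists_thin_svd B
  let e := (Fintype.equivFin ι).symm
  let σ : Equiv.Perm (Fin (Fintype.card ι)) := Tuple.sort fun i => OrderDual.toDual (μ (e i))
  let g : Fin (Fintype.card ι) ≃ ι := σ.trans e
  have hanti : Antitone (μ ∘ g) := fun i j hij =>
    Tuple.monotone_sort (fun i => OrderDual.toDual (μ (e i))) hij
  have hsub : ∀ {k : ℕ} {Z : Matrix (Fin k) ι ℂ[ε]}, Zᴴ * Z = 1 →
      (Z.submatrix id g)ᴴ * Z.submatrix id g = 1 := fun {k Z} hZ => by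
    rw [Matrix.conjTranspose_submatrix, ← Matrix.submatrix_mul _ _ _ _ _ Function.bijective_id, hZ,
      Matrix.submatrix_one_equiv]
  obtain ⟨hm, U, hU, hUX⟩ := exists_unitary_completion _ (hsub hX)
  obtain ⟨hn, V, hV, hVY⟩ := exists_unitary_completion _ (hsub hY)
  refine ⟨Fintype.card ι, U, V, μ ∘ g, hU, hV, hm, hn, fun j => hμ _, hanti, ?_⟩
  have horth : ∀ {k : ℕ} (h : Fintype.card ι ≤ k) {Z : Matrix (Fin k) (Fin k) ℂ[ε]}
      {Z' : Matrix (Fin k) ι ℂ[ε]}, Z ∈ Matrix.unitaryGroup (Fin k) ℂ[ε] →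
      (∀ (i j : Fin k) (h : (j : ℕ) < Fintype.card ι), Z i j = Z'.submatrix id g i ⟨j, h⟩) →
      ∀ (i : Fin k) (l : Fin (Fintype.card ι)),
        (Zᴴ * Z') i (g l) = if (i : ℕ) = l then 1 else 0 := by
    intro k hk Z Z' hZ hZZ' i l
    rw [Matrix.mem_unitaryGroup_iff'] at hZ
    have := congrFun (congrFun hZ i) (Fin.castLE hk l)
    rw [Matrix.one_apply] at this
    simp only [Fin.ext_iff, Fin.val_castLE] at this
    rw [← this, Matrix.star_eq_conjTranspose, Matrix.mul_apply, Matrix.mul_apply]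
    refine Finset.sum_congr rfl fun a _ => ?_
    rw [hZZ' a (Fin.castLE hk l) l.2]
    rfl
  have hassoc : Uᴴ * B * V = (Uᴴ * X) * Matrix.diagonal (fun i => ofDual (μ i)) * (Vᴴ * Y)ᴴ := by
    rw [hB, Matrix.conjTranspose_mul, Matrix.conjTranspose_conjTranspose]
    simp only [Matrix.mul_assoc]
  rw [hassoc]
  ext1 i j
  rw [Matrix.mul_apply, ← g.sum_comp]
  simp only [Matrix.mul_diagonal, Matrix.conjTranspose_apply, horth hm hU hUX, horth hn hV hVY,
    rectDiagonal, Matrix.of_apply]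
  by_cases hi : (i : ℕ) < Fintype.card ι
  · rw [dif_pos hi, Finset.sum_eq_single ⟨i, hi⟩]
    · by_cases hij : (i : ℕ) = j
      · simp [hij]
      · simp [hij, Ne.symm hij]
    · intro l _ hl
      have : ¬ (i : ℕ) = l := fun h => hl (Fin.ext h.symm)
      simp [this]
    · simp
  · rw [dif_neg hi]
    refine Finset.sum_eq_zero fun l _ => ?_
    have : ¬ (i : ℕ) = l := fun h => hi (h ▸ l.2)
    simp [this]

/-- A dual matrix of rank at most `k` factors through `k` or fewer dimensions. -/
theorem exists_factorization_of_rank_le {m n k : ℕ} {B : Matrix (Fin m) (Fin n) ℂ[ε]}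
    (hB : rank B ≤ k) : ∃ (t : ℕ) (C : Matrix (Fin m) (Fin t) ℂ[ε])
      (D : Matrix (Fin t) (Fin n) ℂ[ε]), t ≤ k ∧ B = C * D := by
  -- nonemptiness matters: the infimum of the empty set would be `0`
  have hne : {t : ℕ | ∃ U V, ∃ μ : Fin t → ℝ[ε], IsSVD B t U V μ}.Nonempty := exists_isSVD B
  obtain ⟨U, V, μ, h⟩ := Nat.sInf_mem hne
  have hR : ∀ {t : ℕ} (μ : Fin t → ℝ[ε]), (rectDiagonal μ : Matrix (Fin m) (Fin n) ℂ[ε]) =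
      (Matrix.of fun (i : Fin m) (l : Fin t) => if (i : ℕ) = l then ofDual (μ l) else 0) *
        Matrix.of fun (l : Fin t) (j : Fin n) => if (l : ℕ) = j then (1 : ℂ[ε]) else 0 := by
    intro t μ
    ext1 i j
    simp only [rectDiagonal, Matrix.mul_apply, Matrix.of_apply]
    by_cases hi : (i : ℕ) < t
    · rw [dif_pos hi, Finset.sum_eq_single ⟨i, hi⟩]
      · simp
      · intro l _ hl
        have : ¬ (i : ℕ) = l := fun h => hl (Fin.ext h.symm)
        simp [this]
      · simp
    · rw [dif_neg hi]
      refine (Finset.sum_eq_zero fun l _ => ?_).symm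
      have : ¬ (i : ℕ) = l := fun h => hi (h ▸ l.2)
      simp [this]
  have hU : U * Uᴴ = 1 := Matrix.mem_unitaryGroup_iff.mp h.unitary_left
  have hV : V * Vᴴ = 1 := Matrix.mem_unitaryGroup_iff.mp h.unitary_right
  have hBR : B = U * (rectDiagonal μ : Matrix (Fin m) (Fin n) ℂ[ε]) * Vᴴ := by
    rw [← h.eq_diagonal, Matrix.mul_assoc, Matrix.mul_assoc, hV, Matrix.mul_one,
      ← Matrix.mul_assoc, hU, Matrix.one_mul]
  rw [hR, Matrix.mul_assoc, Matrix.mul_assoc, ← Matrix.mul_assoc U] at hBR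
  exact ⟨_, _, _, hB, hBR⟩

/-! ### The best approximation -/

theorem svdSum_eq_mul {m n r : ℕ} (μ : Fin r → ℝ[ε]) (u : Fin r → Fin m → ℂ[ε])
    (v : Fin r → Fin n → ℂ[ε]) : svdSum μ u v =
      (Matrix.of u)ᵀ * Matrix.diagonal (fun j => ofDual (μ j)) * ((Matrix.of v)ᵀ)ᴴ := by
  ext1 i j
  simp only [svdSum, Matrix.sum_apply, Matrix.smul_apply, Matrix.vecMulVec_apply, Matrix.mul_apply
    (N := (Matrix.of v)ᵀᴴ), Matrix.mul_diagonal, Matrix.conjTranspose_apply,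
    Matrix.transpose_apply, Matrix.of_apply, Pi.star_apply, smul_eq_mul]
  exact Finset.sum_congr rfl fun l _ => by ring

theorem IsOrthonormal.isometry {n r : ℕ} {u : Fin r → Fin n → ℂ[ε]} (hu : IsOrthonormal u) :
    ((Matrix.of u)ᵀ)ᴴ * (Matrix.of u)ᵀ = 1 := by
  ext1 i j
  rw [Matrix.one_apply, ← hu i j]
  rfl

/-- The difference between the full sum and its first `k` terms is the tail. -/
theorem svdSum_sub_castLE {m n r k : ℕ} (hk : k ≤ r) (μ : Fin r → ℝ[ε]) (u : Fin r → Fin m → ℂ[ε])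
    (v : Fin r → Fin n → ℂ[ε]) :
    svdSum μ u v - svdSum (fun j : Fin k => μ (Fin.castLE hk j)) (fun j => u (Fin.castLE hk j))
      (fun j => v (Fin.castLE hk j)) =
    (Matrix.of u)ᵀ * (Matrix.diagonal fun j : Fin r => if (j : ℕ) < k then 0 else ofDual (μ j)) *
      ((Matrix.of v)ᵀ)ᴴ := by
  obtain ⟨l, rfl⟩ := Nat.exists_eq_add_of_le hk
  ext1 i j
  simp only [svdSum, Matrix.sub_apply, Matrix.add_apply, Matrix.sum_apply,
    Matrix.smul_apply, Matrix.vecMulVec_apply,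
    Matrix.mul_apply (N := (Matrix.of v)ᵀᴴ), Matrix.mul_diagonal, Matrix.conjTranspose_apply,
    Matrix.transpose_apply, Matrix.of_apply, Pi.star_apply, smul_eq_mul, Fin.sum_univ_add]
  have h1 : ∀ a : Fin k, (Fin.castLE hk a) = Fin.castAdd l a := fun _ => rfl
  simp only [h1, Fin.val_castAdd, Fin.is_lt, if_true, Fin.val_natAdd, mul_zero, zero_mul,
    Finset.sum_const_zero, zero_add, add_sub_cancel_left, not_lt.mpr (Nat.le_add_right k _),
    if_false]
  exact Finset.sum_congr rfl fun a _ => by ring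

end DualComplex

theorem theorem7p1 (m n r k : ℕ) (A : Matrix (Fin m) (Fin n) (DualNumber ℂ))
    (μ : Fin r → DualNumber ℝ) (u : Fin r → Fin m → DualNumber ℂ)
    (v : Fin r → Fin n → DualNumber ℂ)
    (hu : DualComplex.IsOrthonormal u) (hv : DualComplex.IsOrthonormal v)
    (hμ_pos : ∀ j, 0 < μ j) (hμ : Antitone μ)
    (hA : A = DualComplex.svdSum μ u v) (hk : k ≤ r)
    (B : Matrix (Fin m) (Fin n) (DualNumber ℂ)) (hB : DualComplex.rank B ≤ k) :
    DualComplex.frobeniusNorm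
        (A - DualComplex.svdSum (fun j : Fin k => μ (Fin.castLE hk j))
          (fun j => u (Fin.castLE hk j)) (fun j => v (Fin.castLE hk j)))
      ≤ DualComplex.frobeniusNorm (A - B) := by
  obtain ⟨t, C, D, ht, hCD⟩ := DualComplex.exists_factorization_of_rank_le hB
  have hX := hu.isometry
  have hY := hv.isometry
  have hAXY := DualComplex.svdSum_eq_mul μ u v
  rw [hA, DualComplex.svdSum_sub_castLE hk, hAXY, hCD]
  generalize (Matrix.of u)ᵀ = X at *
  generalize (Matrix.of v)ᵀ = Y at *
  have hmid : Matrix.diagonal (fun j => DualComplex.ofDual (μ j)) - Xᴴ * C * (D * Y) =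
      Xᴴ * (X * Matrix.diagonal (fun j => DualComplex.ofDual (μ j)) * Yᴴ - C * D) * Y := by
    simp only [Matrix.mul_sub, Matrix.sub_mul, Matrix.mul_assoc, hY, Matrix.mul_one]
    rw [← Matrix.mul_assoc Xᴴ X, hX, Matrix.one_mul]
  refine (DualComplex.frobeniusNorm_mul_le' _ Yᴴ (Or.inr (by simpa using hY))).trans ?_
  refine (DualComplex.frobeniusNorm_mul_le X (Or.inl hX) _).trans ?_
  refine (DualComplex.frobeniusNorm_diagonal_tail_le μ hμ hμ_pos (Xᴴ * C) (D * Y) ht).trans ?_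
  rw [hmid]
  exact (DualComplex.frobeniusNorm_mul_le' _ Y (Or.inl hY)).trans
    (DualComplex.frobeniusNorm_mul_le Xᴴ (Or.inr (by simpa using hX)) _)
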